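/- Let $f:[0,1]\to\mathbb{R}$ be locally increasing and power bounded at $0$: there are $\epsilon\in(0,1]$ and real numbers $a,b,r>0$ such that $f$ is (not necessarily strictly) increasing on $[0,\epsilon]$ and $a x^r\le f(x)\le b x^r$ for all $x\in[0,\epsilon]$; fix such $\epsilon,a,b,r$. Let $m\ge 1$, let $k_1\ge k_2\ge\dots\ge k_m>0$ be real numbers, put $K=k_1+\dots+k_m$, and for $x\in(0,1)$ let $(w_n(x))_{n\ge 1}$ be the sequence $$k_1f(x),\dots,k_mf(x),\,k_1f(x^2),\dots,k_mf(x^2),\,k_1f(x^3),\dots,$$ with achievement set $E(w_n(x))=\left\{\sum_{n\in A}w_n(x) : A\subseteq\mathbb{N}\right\}$. Suppose that $\lambda,\mu>0$ are real numbers and $s\ge 0$ is an integer such that each of $\mu,\mu+\lambda,\dots,\mu+s\lambda$ is a subsum of $k_1,\dots,k_m$, that is, of the form $\sum_{i\in I}k_i$ with $I\subseteq\{1,\dots,m\}$. Set $$d_{CI}=\sqrt[r]{\frac{b}{sa+b}},\qquad d_{NI}=\sqrt[r]{\frac{ak_m}{bK+ak_m}}.$$ If $d_{CI}<d_{NI}$,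 then for every $x\in[d_{CI},d_{NI})$ the achievement set $E(w_n(x))$ is a Cantorval, i.e. a nonempty compact subset of $\mathbb{R}$ that is the closure of its interior and in which both endpoints of every nontrivial connected component are accumulation points of the set of points forming trivial (one-point) components. -/

import Mathlib

open Set Filter Topology

/-- The achievement set of a real sequence: all sums of (unconditionally convergent) subseries. -/
def achievementSet (z : ℕ → ℝ) : Set ℝ :=
  {y | ∃ A : Set ℕ, HasSum (A.indicator z) y}

/-- The points of `S` whose connected component in `S` is a single point. -/
def trivialComponents (S : Set ℝ) : Set ℝ :=
  {y | y ∈ S ∧ connectedComponentIn S y = {y}}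

/-- A (symmetric) Cantorval: a nonempty compact subset of the line that is the closure of its
interior and such that both endpoints of every nontrivial connected component are accumulation
points of trivial components. (The nontrivial components of a compact subset of the line are its
components of the form `[p, q]` with `p < q`.) -/
structure IsCantorval (S : Set ℝ) : Prop where
  nonempty : S.Nonempty
  isCompact : IsCompact S
  closure_interior : closure (interior S) = S
  accPt_endpoints : ∀ p q : ℝ, p < q → connectedComponentIn S p = Icc p q →
    AccPt p (𝓟 (trivialComponents S)) ∧ AccPt q (𝓟 (trivialComponents S))

/-- `f` is locally increasing and power bounded at `0`, with witnesses `ε, a, b, r`. -/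
structure IsLocallyIncreasingPowerBounded (f : ℝ → ℝ) (ε a b r : ℝ) : Prop where
  ε_pos : 0 < ε
  ε_le_one : ε ≤ 1
  a_pos : 0 < a
  b_pos : 0 < b
  r_pos : 0 < r
  monotoneOn : MonotoneOn f (Icc 0 ε)
  lower : ∀ x ∈ Icc 0 ε, a * x ^ r ≤ f x
  upper : ∀ x ∈ Icc 0 ε, f x ≤ b * x ^ r

/-- The terms `k₁ f(x), …, kₘ f(x), k₁ f(x²), …, kₘ f(x²), …` of the generalized multigeometric
series. Both the sequence and the scalars are indexed from `0` here. -/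
def genMultigeometric {m : ℕ} (hm : 0 < m) (k : Fin m → ℝ) (f : ℝ → ℝ) (x : ℝ) (n : ℕ) : ℝ :=
  k ⟨n % m, Nat.mod_lt n hm⟩ * f (x ^ (n / m + 1))

/-- The set of subsums of the finite series `k₁ + ⋯ + kₘ`. -/
def finiteSubsums {m : ℕ} (k : Fin m → ℝ) : Set ℝ :=
  {y | ∃ I : Finset (Fin m), ∑ i ∈ I, k i = y}

/-- `d_CI`, the `r`-th root of `b / (s a + b)`. -/
noncomputable def dCI (a b r : ℝ) (s : ℕ) : ℝ :=
  (b / (s * a + b)) ^ (1 / r)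

/-- `d_NI`, the `r`-th root of `a kₘ / (b K + a kₘ)`, where `K = k₁ + ⋯ + kₘ` and `kₘ` is the last
of the scalars. -/
noncomputable def dNI {m : ℕ} (hm : 0 < m) (k : Fin m → ℝ) (a b r : ℝ) : ℝ :=
  (a * k ⟨m - 1, Nat.sub_one_lt_of_lt hm⟩ /
    (b * (∑ i, k i) + a * k ⟨m - 1, Nat.sub_one_lt_of_lt hm⟩)) ^ (1 / r)

/-! Put `q = x ^ r` and `u n = f (x ^ (n + 1))`. Far out, `u` lies between geometric sequences of
ratio `q`. The bound `dCI ≤ x` makes each `u n` at most `s` times the tail after it, so Kakeya's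
greedy algorithm with digits `0, …, s` yields an interval in every late tail's achievement set
(`interior_achievementSet_blockSeq_nonempty`); translates of these are dense. The bound `x < dNI`
makes the total after a late block smaller than that block's least term, so tails have gaps just
above arbitrarily small positive numbers. At the right end of a gap, nearby points on the right are
that end plus a tail sum, so the tail gaps reappear there (`exists_notMem_right_of_gap`). Such ends
are trivial components and accumulate at left endpoints of components; the reflection `y ↦ ∑ z - y`
handles right endpoints. -/

theorem mem_achievementSet_iff {z : ℕ → ℝ} (hz : Summable z) {y : ℝ} :
    y ∈ achievementSet z ↔ ∃ A : Set ℕ, ∑' n, A.indicator z n = y :=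
  ⟨fun ⟨A, hA⟩ => ⟨A, hA.tsum_eq⟩, fun ⟨A, hA⟩ => ⟨A, hA ▸ (hz.indicator A).hasSum⟩⟩

theorem zero_mem_achievementSet (z : ℕ → ℝ) : (0 : ℝ) ∈ achievementSet z :=
  ⟨∅, by simp⟩

theorem isCompact_achievementSet {z : ℕ → ℝ} (hz : Summable z) :
    IsCompact (achievementSet z) := by
  have hc : Continuous fun c : ℕ → Bool => ∑' n, (if c n then z n else 0) := by
    refine continuous_tsum (u := fun n => ‖z n‖) (fun n => ?_) hz.norm fun n c => ?_
    · exact (continuous_of_discreteTopology (f := fun t : Bool => if t then z n else 0)).comp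
        (continuous_apply n)
    · split_ifs <;> simp
  convert isCompact_range hc using 1
  ext y
  rw [mem_achievementSet_iff hz]
  classical
  constructor
  · rintro ⟨A, rfl⟩
    exact ⟨fun n => decide (n ∈ A), by simp [Set.indicator_apply]⟩
  · rintro ⟨c, rfl⟩
    exact ⟨{n | c n = true}, by simp [Set.indicator_apply]⟩

theorem tsum_sub_mem_achievementSet {z : ℕ → ℝ} (hz : Summable z) {y : ℝ}
    (hy : y ∈ achievementSet z) : (∑' n, z n) - y ∈ achievementSet z := by
  obtain ⟨A, hA⟩ := hy
  refine ⟨Aᶜ, ?_⟩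
  rw [Set.indicator_compl]
  exact hz.hasSum.sub hA

theorem nonneg_of_mem_achievementSet {z : ℕ → ℝ} (hz : ∀ n, 0 ≤ z n) {y : ℝ}
    (hy : y ∈ achievementSet z) : 0 ≤ y := by
  obtain ⟨A, hA⟩ := hy
  exact hA.nonneg fun n => Set.indicator_nonneg (fun i _ => hz i) n

theorem le_tsum_of_mem_achievementSet {z : ℕ → ℝ} (hs : Summable z) (hz : ∀ n, 0 ≤ z n) {y : ℝ}
    (hy : y ∈ achievementSet z) : y ≤ ∑' n, z n := by
  obtain ⟨A, hA⟩ := hy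
  exact hasSum_le (fun n => Set.indicator_le_self' (fun i _ => hz i) n) hA hs.hasSum

theorem sum_add_mem_achievementSet {z : ℕ → ℝ} {N : ℕ} {B : Finset ℕ} (hB : B ⊆ Finset.range N)
    {e : ℝ} (he : e ∈ achievementSet fun i => z (i + N)) :
    ∑ i ∈ B, z i + e ∈ achievementSet z := by
  obtain ⟨A, hA⟩ := he
  refine ⟨B ∪ (· + N) '' A, ?_⟩
  rw [add_comm]
  have h1 : ∑ i ∈ B, z i =
      ∑ i ∈ Finset.range N, ((B : Set ℕ) ∪ (· + N) '' A).indicator z i := by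
    rw [← Finset.sum_subset hB]
    · refine Finset.sum_congr rfl fun i hi => ?_
      exact (Set.indicator_of_mem (Set.mem_union_left _ (Finset.mem_coe.2 hi)) z).symm
    · intro i hi hiB
      refine Set.indicator_of_notMem ?_ _
      rintro (h | ⟨j, _, rfl⟩)
      · exact hiB h
      · simp at hi
  rw [h1, ← hasSum_nat_add_iff N]
  refine hA.congr_fun fun i => ?_
  have h2 : i + N ∉ B := fun h => by simpa using hB h
  by_cases hi : i ∈ A
  · rw [Set.indicator_of_mem hi, Set.indicator_of_mem (Set.mem_union_right _ (Set.mem_image_of_mem (· + N) hi))]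
  · rw [Set.indicator_of_notMem hi, Set.indicator_of_notMem]
    simp [h2, hi]

theorem exists_sum_add_of_mem_achievementSet {z : ℕ → ℝ} (N : ℕ) {y : ℝ}
    (hy : y ∈ achievementSet z) :
    ∃ B ⊆ Finset.range N, ∃ e ∈ achievementSet fun i => z (i + N), ∑ i ∈ B, z i + e = y := by
  classical
  obtain ⟨A, hA⟩ := hy
  refine ⟨(Finset.range N).filter (· ∈ A), Finset.filter_subset _ _,
    y - ∑ i ∈ Finset.range N, A.indicator z i, ⟨(· + N) ⁻¹' A, ?_⟩, ?_⟩
  · exact (hasSum_nat_add_iff' N).2 hA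
  · rw [Finset.sum_filter]
    simp [Set.indicator_apply]

/-! ### Gap ends and trivial components -/

/-- A point of `S` that is isolated from the left by a gap and has points outside `S` arbitrarily
close to its right forms a trivial component. -/
theorem mem_trivialComponents {S : Set ℝ} {y z : ℝ} (hy : y ∈ S) (hzy : z < y)
    (hz : ∀ t ∈ S, z < t → y ≤ t) (hr : ∀ η > 0, ∃ c ∈ Ioo y (y + η), c ∉ S) :
    y ∈ trivialComponents S := by
  refine ⟨hy, Subset.antisymm (fun t ht => ?_) (by simpa using mem_connectedComponentIn hy)⟩
  have hoc : OrdConnected (connectedComponentIn S y) :=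
    isPreconnected_connectedComponentIn.ordConnected
  have hsub := connectedComponentIn_subset S y
  have hyc := mem_connectedComponentIn hy
  rcases lt_trichotomy t y with h | h | h
  · have h1 : max t ((z + y) / 2) ∈ S := hsub <| hoc.out ht hyc
      ⟨le_max_left _ _, max_le h.le (by linarith)⟩
    have h2 := hz _ h1 (lt_max_of_lt_right (by linarith))
    rcases le_max_iff.1 h2 with h3 | h3 <;> linarith
  · exact h
  · obtain ⟨c, hc, hcS⟩ := hr (t - y) (by linarith)
    exact absurd (hsub <| hoc.out hyc ht ⟨hc.1.le, by linarith [hc.2]⟩) hcS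

/-- If every right end of a gap of a compact set has points of the complement arbitrarily close to
its right, then left endpoints of nontrivial components are limits of trivial components. -/
theorem accPt_left_endpoint {S : Set ℝ} (hS : IsCompact S)
    (hgap : ∀ y ∈ S, ∀ z < y, (∀ t ∈ S, z < t → y ≤ t) →
      ∀ η > 0, ∃ c ∈ Ioo y (y + η), c ∉ S)
    {p q : ℝ} (hpq : p < q) (hcomp : connectedComponentIn S p = Icc p q) :
    AccPt p (𝓟 (trivialComponents S)) := by
  have hsub : Icc p q ⊆ S := hcomp ▸ connectedComponentIn_subset S p
  have hpS : p ∈ S := hsub (left_mem_Icc.2 hpq.le)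
  rw [accPt_iff_nhds]
  intro U hU
  obtain ⟨δ, hδ, hball⟩ := Metric.mem_nhds_iff.1 hU
  obtain ⟨z, hz, hzS⟩ : ∃ z ∈ Ioo (p - δ) p, z ∉ S := by
    by_contra! h
    have h1 : Icc (p - δ / 2) q ⊆ S := fun t ht => by
      rcases lt_or_ge t p with htp | htp
      · exact h t ⟨by linarith [ht.1], htp⟩
      · exact hsub ⟨htp, ht.2⟩
    have h2 := isPreconnected_Icc.subset_connectedComponentIn
      (show p ∈ Icc (p - δ / 2) q from ⟨by linarith, hpq.le⟩) h1
    rw [hcomp] at h2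
    have h3 := (h2 (left_mem_Icc.2 (by linarith))).1
    linarith
  -- The first point of `S` after the missing point `z` ends a gap and lies between `z` and `p`.
  obtain ⟨y, hy, hymin⟩ := (hS.inter_right (isClosed_Ici (a := z))).exists_isLeast
    ⟨p, hpS, hz.2.le⟩
  have hzy : z < y := lt_of_le_of_ne hy.2 fun h => hzS (h ▸ hy.1)
  have hmin : ∀ t ∈ S, z < t → y ≤ t := fun t ht hzt => hymin ⟨ht, hzt.le⟩
  have htriv := mem_trivialComponents hy.1 hzy hmin (hgap y hy.1 z hzy hmin)
  have hyp : y ≤ p := hmin p hpS hz.2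
  refine ⟨y, ⟨hball ?_, htriv⟩, ?_⟩
  · rw [Metric.mem_ball, Real.dist_eq, abs_lt]
    constructor <;> linarith [hz.1]
  · rintro rfl
    have h1 : q ∈ ({y} : Set ℝ) := by
      rw [← htriv.2, hcomp]
      exact right_mem_Icc.2 hpq.le
    exact hpq.ne' h1

theorem connectedComponentIn_image_neg (S : Set ℝ) {y : ℝ} (hy : y ∈ S) :
    connectedComponentIn (-S) (-y) = -connectedComponentIn S y := by
  have := (Homeomorph.neg ℝ).image_connectedComponentIn hy
  simpa using this.symm

theorem trivialComponents_neg (S : Set ℝ) : trivialComponents (-S) = -trivialComponents S := by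
  ext y
  simp only [trivialComponents, Set.mem_ofPred_eq, Set.mem_neg]
  refine and_congr_right fun hy => ?_
  have := connectedComponentIn_image_neg S hy
  rw [neg_neg] at this
  rw [this, neg_eq_iff_eq_neg]
  simp

theorem accPt_right_endpoint {S : Set ℝ} (hS : IsCompact S)
    (hgap : ∀ y ∈ S, ∀ z > y, (∀ t ∈ S, t < z → t ≤ y) →
      ∀ η > 0, ∃ c ∈ Ioo (y - η) y, c ∉ S)
    {p q : ℝ} (hpq : p < q) (hcomp : connectedComponentIn S p = Icc p q) :
    AccPt q (𝓟 (trivialComponents S)) := by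
  have hsub : Icc p q ⊆ S := hcomp ▸ connectedComponentIn_subset S p
  have hqS : q ∈ S := hsub (right_mem_Icc.2 hpq.le)
  have hq : connectedComponentIn S q = Icc p q := by
    rw [← hcomp]
    exact (connectedComponentIn_eq (hcomp ▸ right_mem_Icc.2 hpq.le)).symm
  have key : AccPt (-q) (𝓟 (trivialComponents (-S))) := by
    refine accPt_left_endpoint hS.neg ?_ (neg_lt_neg hpq) ?_
    · intro y hy z hzy hmin η hη
      obtain ⟨c, hc, hcS⟩ := hgap (-y) hy (-z) (neg_lt_neg hzy)
        (fun t ht htz => by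
          have := hmin (-t) (by simpa using ht) (by linarith)
          linarith) η hη
      exact ⟨-c, ⟨by linarith [hc.2], by linarith [hc.1]⟩, by simpa using hcS⟩
    · rw [connectedComponentIn_image_neg S hqS, hq]
      simp
  rw [accPt_iff_nhds] at key ⊢
  intro U hU
  obtain ⟨y, ⟨hyU, hy⟩, hne⟩ := key (-U) (by
    have : Tendsto (fun t : ℝ => -t) (𝓝 (-q)) (𝓝 q) := by
      simpa using (continuous_neg (G := ℝ)).tendsto (-q)
    exact this hU)
  rw [trivialComponents_neg] at hy
  exact ⟨-y, ⟨hyU, hy⟩, fun h => hne (by linarith)⟩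

/-! ### Gaps and interior of achievement sets -/

section Cantorval

variable {z : ℕ → ℝ} {n₀ : ℕ}

/-- Either no index in `[N, n)` is used, or one is and it alone contributes at least `c`. -/
theorem mem_achievementSet_tail_gap (hz : Summable z) (hpos : ∀ n ≥ n₀, 0 ≤ z n) {N n : ℕ}
    (hN : n₀ ≤ N) (hNn : N ≤ n) {c : ℝ} (hc : ∀ i, n₀ ≤ i → i < n → c ≤ z i) {e : ℝ}
    (he : e ∈ achievementSet fun i => z (i + N)) : e ≤ ∑' i, z (i + n) ∨ c ≤ e := by
  obtain ⟨B, hB, e', he', rfl⟩ := exists_sum_add_of_mem_achievementSet (n - N) he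
  have h1 : (fun i => z (i + (n - N) + N)) = fun i => z (i + n) := by
    ext i
    congr 1
    omega
  rw [h1] at he'
  have hpos' : ∀ i, 0 ≤ z (i + n) := fun i => hpos _ (by omega)
  rcases B.eq_empty_or_nonempty with rfl | ⟨i, hi⟩
  · left
    simpa using le_tsum_of_mem_achievementSet ((summable_nat_add_iff n).2 hz) hpos' he'
  · right
    have h2 := nonneg_of_mem_achievementSet hpos' he'
    have h3 : z (i + N) ≤ ∑ j ∈ B, z (j + N) :=
      Finset.single_le_sum (f := fun j => z (j + N)) (fun j _ => hpos _ (by omega)) hi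
    have h4 := hc (i + N) (by omega) (by have := Finset.mem_range.1 (hB hi); omega)
    linarith

theorem exists_notMem_right_of_gap (hz : Summable z) (hpos : ∀ n ≥ n₀, 0 ≤ z n)
    (hgap : ∀ N, ∃ n ≥ N, ∃ c, ∑' i, z (i + n) < c ∧ ∀ i, n₀ ≤ i → i < n → c ≤ z i)
    {y x : ℝ} (hxy : x < y)
    (hmin : ∀ t ∈ achievementSet z, x < t → y ≤ t) {η : ℝ} (hη : 0 < η) :
    ∃ c ∈ Ioo y (y + η), c ∉ achievementSet z := by
  have htail := tendsto_sum_nat_add z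
  -- With the tail shorter than the gap, the finite part of any sum above `y` still exceeds `x`,
  -- hence is at least `y`.
  obtain ⟨N, hNx, hN⟩ := ((htail.eventually_lt_const (sub_pos.2 hxy)).and
    (eventually_ge_atTop n₀)).exists
  let F : Finset ℝ := ((Finset.range N).powerset.image fun B => ∑ i ∈ B, z i)
  obtain ⟨δ, hδ, hF⟩ : ∃ δ > 0, ∀ t ∈ F, y < t → y + δ ≤ t := by
    by_cases h : (F.filter (y < ·)).Nonempty
    · refine ⟨(F.filter (y < ·)).min' h - y, ?_, fun t ht hyt => ?_⟩
      · exact sub_pos.2 (Finset.mem_filter.1 (Finset.min'_mem _ h)).2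
      · have := Finset.min'_le _ t (Finset.mem_filter.2 ⟨ht, hyt⟩)
        linarith
    · exact ⟨1, one_pos, fun t ht hyt => absurd ⟨t, Finset.mem_filter.2 ⟨ht, hyt⟩⟩ h⟩
  obtain ⟨M, hM⟩ := eventually_atTop.1 (htail.eventually_lt_const (lt_min hδ hη))
  obtain ⟨n, hn, c, hc, hcz⟩ := hgap (max N M)
  have hr := hM n (le_of_max_le_right hn)
  have hr0 : 0 ≤ ∑' i, z (i + n) :=
    tsum_nonneg fun i => hpos _ (by have := le_of_max_le_left hn; omega)
  -- `v < δ` forces the finite part to equal `y`; then `v` would be a tail sum inside a tail gap.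
  obtain ⟨v, hv1, hv2⟩ := exists_between (lt_min hc hr)
  have hvc := hv2.trans_le (min_le_left _ _)
  have hvδ := hv2.trans_le ((min_le_right _ _).trans (min_le_left _ _))
  have hvη := hv2.trans_le ((min_le_right _ _).trans (min_le_right _ _))
  refine ⟨y + v, ⟨by linarith, by linarith⟩, fun hmem => ?_⟩
  obtain ⟨B, hB, e, he, hsum⟩ := exists_sum_add_of_mem_achievementSet N hmem
  have hpos' : ∀ i, 0 ≤ z (i + N) := fun i => hpos _ (by omega)
  have he0 := nonneg_of_mem_achievementSet hpos' he
  have heN := le_tsum_of_mem_achievementSet ((summable_nat_add_iff N).2 hz) hpos' he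
  have hBS : ∑ i ∈ B, z i ∈ achievementSet z := by
    simpa using sum_add_mem_achievementSet hB (zero_mem_achievementSet fun i => z (i + N))
  have hyB := hmin _ hBS (by linarith)
  rcases hyB.eq_or_lt with h | h
  · have hev : e = v := by linarith
    subst hev
    rcases mem_achievementSet_tail_gap hz hpos hN (le_of_max_le_left hn) hcz he with h' | h'
    · linarith
    · linarith
  · have := hF _ (Finset.mem_image_of_mem _ (Finset.mem_powerset.2 hB)) h
    linarith

/-- Replacing the tail part of a sum by an interior point of the tail's set moves it by less than
`δ`. -/
theorem closure_interior_achievementSet (hz : Summable z) (hpos : ∀ n ≥ n₀, 0 ≤ z n)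
    (hint : ∀ N, ∃ n ≥ N, (interior (achievementSet fun i => z (i + n))).Nonempty) :
    closure (interior (achievementSet z)) = achievementSet z := by
  refine Subset.antisymm
    (closure_minimal interior_subset (isCompact_achievementSet hz).isClosed) fun y hy => ?_
  rw [Metric.mem_closure_iff]
  intro δ hδ
  obtain ⟨M, hM⟩ := eventually_atTop.1 ((tendsto_sum_nat_add z).eventually_lt_const hδ)
  obtain ⟨n, hn, v, hv⟩ := hint (max M n₀)
  have hr := hM n (le_of_max_le_left hn)
  obtain ⟨B, hB, e, he, rfl⟩ := exists_sum_add_of_mem_achievementSet n hy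
  have hpos' : ∀ i, 0 ≤ z (i + n) := fun i => hpos _ (by have := le_of_max_le_right hn; omega)
  have hs := (summable_nat_add_iff n).2 hz
  have he0 := nonneg_of_mem_achievementSet hpos' he
  have he1 := le_tsum_of_mem_achievementSet hs hpos' he
  have hv0 := nonneg_of_mem_achievementSet hpos' (interior_subset hv)
  have hv1 := le_tsum_of_mem_achievementSet hs hpos' (interior_subset hv)
  refine ⟨∑ i ∈ B, z i + v, ?_, ?_⟩
  · rw [mem_interior_iff_mem_nhds] at hv ⊢
    have hcont : Tendsto (fun t : ℝ => t - ∑ i ∈ B, z i) (𝓝 (∑ i ∈ B, z i + v)) (𝓝 v) := by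
      have : Continuous fun t : ℝ => t - ∑ i ∈ B, z i := by fun_prop
      simpa using this.tendsto (∑ i ∈ B, z i + v)
    refine mem_of_superset (hcont hv) fun t ht => ?_
    simpa using sum_add_mem_achievementSet hB ht
  · rw [Real.dist_eq, abs_lt]
    constructor <;> linarith

/-- A summable, eventually nonnegative sequence whose achievement set has infinitely many scales of
gaps, and whose tails have achievement sets with interior points, achieves a Cantorval. -/
theorem isCantorval_achievementSet (hz : Summable z) (hpos : ∀ n ≥ n₀, 0 ≤ z n)
    (hgap : ∀ N, ∃ n ≥ N, ∃ c, ∑' i, z (i + n) < c ∧ ∀ i, n₀ ≤ i → i < n → c ≤ z i)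
    (hint : ∀ N, ∃ n ≥ N, (interior (achievementSet fun i => z (i + n))).Nonempty) :
    IsCantorval (achievementSet z) where
  nonempty := ⟨0, zero_mem_achievementSet z⟩
  isCompact := isCompact_achievementSet hz
  closure_interior := closure_interior_achievementSet hz hpos hint
  accPt_endpoints p q hpq hcomp := by
    refine ⟨accPt_left_endpoint (isCompact_achievementSet hz) ?_ hpq hcomp,
      accPt_right_endpoint (isCompact_achievementSet hz) ?_ hpq hcomp⟩
    · exact fun y _ x hxy hmin η hη => exists_notMem_right_of_gap hz hpos hgap hxy hmin hη
    · intro y _ x hxy hmax η hη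
      obtain ⟨c, hc, hcS⟩ := exists_notMem_right_of_gap hz hpos hgap
        (x := ∑' n, z n - x) (y := ∑' n, z n - y) (by linarith) (fun t ht htx => by
          have := hmax _ (tsum_sub_mem_achievementSet hz ht) (by linarith)
          linarith) hη
      refine ⟨∑' n, z n - c, ⟨by linarith [hc.2], by linarith [hc.1]⟩, fun h => hcS ?_⟩
      simpa using tsum_sub_mem_achievementSet hz h

end Cantorval

/-! ### Block sequences -/

/-- The sequence `k₁ u₀, …, kₘ u₀, k₁ u₁, …, kₘ u₁, …`. -/
def blockSeq {m : ℕ} (hm : 0 < m) (k : Fin m → ℝ) (u : ℕ → ℝ) (n : ℕ) : ℝ :=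
  k ⟨n % m, Nat.mod_lt n hm⟩ * u (n / m)

section blockSeq

variable {m : ℕ} (hm : 0 < m) (k : Fin m → ℝ) {u : ℕ → ℝ}

theorem blockSeq_add_mul (N i : ℕ) :
    blockSeq hm k u (i + N * m) = blockSeq hm k (fun j => u (j + N)) i := by
  simp [blockSeq, Nat.add_mul_div_right _ _ hm]

theorem summable_blockSeq (hu : Summable u) : Summable (blockSeq hm k u) := by
  have : NeZero m := ⟨hm.ne'⟩
  rw [← (Nat.divModEquiv m).symm.summable_iff]
  refine (summable_mul_of_summable_norm hu.norm (g := k) (Summable.of_finite)).congr fun p => ?_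
  simp [blockSeq, mul_comm, Nat.add_mul_div_left _ _ hm, Nat.div_eq_of_lt p.2.is_lt,
    Nat.mod_eq_of_lt p.2.is_lt, add_comm]

theorem hasSum_indicator_blockSeq (hu : Summable u) (I : ℕ → Finset (Fin m)) {y : ℝ}
    (hy : HasSum (fun i => (∑ l ∈ I i, k l) * u i) y) :
    HasSum ({n | (⟨n % m, Nat.mod_lt n hm⟩ : Fin m) ∈ I (n / m)}.indicator (blockSeq hm k u))
      y := by
  classical
  have : NeZero m := ⟨hm.ne'⟩
  set A : Set ℕ := {n | (⟨n % m, Nat.mod_lt n hm⟩ : Fin m) ∈ I (n / m)}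
  have hA : HasSum (A.indicator (blockSeq hm k u)) (∑' n, A.indicator (blockSeq hm k u) n) :=
    ((summable_blockSeq hm k hu).indicator A).hasSum
  have h1 := (((Nat.divModEquiv m).symm.hasSum_iff).2 hA).prod_fiberwise fun i => hasSum_fintype _
  have h2 : ∀ i, (∑ l ∈ I i, k l) * u i =
      ∑ l, (A.indicator (blockSeq hm k u) ∘ (Nat.divModEquiv m).symm) (i, l) := by
    intro i
    rw [Finset.sum_mul, ← Finset.sum_filter_add_sum_filter_not Finset.univ (· ∈ I i)]
    rw [Finset.sum_eq_zero (s := Finset.univ.filter (· ∉ I i)), add_zero]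
    · rw [Finset.filter_mem_eq_inter, Finset.univ_inter]
      refine Finset.sum_congr rfl fun l hl => ?_
      simp [A, blockSeq, mul_comm i, Nat.add_mul_div_left _ _ hm, hl,
        Nat.div_eq_of_lt l.is_lt, Nat.mod_eq_of_lt l.is_lt, add_comm]
    · intro l hl
      have hl' := (Finset.mem_filter.1 hl).2
      simp [A, mul_comm i, Nat.add_mul_div_left _ _ hm, hl',
        Nat.div_eq_of_lt l.is_lt, Nat.mod_eq_of_lt l.is_lt, add_comm]
  rw [hy.unique (h1.congr_fun h2)]
  exact hA

theorem tsum_blockSeq (hu : Summable u) :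
    ∑' n, blockSeq hm k u n = (∑ l, k l) * ∑' i, u i := by
  have := hasSum_indicator_blockSeq hm k hu (fun _ => Finset.univ) (hu.hasSum.mul_left (∑ l, k l))
  simpa using this.tsum_eq

end blockSeq

/-! ### Digit expansions and intervals -/

theorem tsum_nat_add_eq_add {u : ℕ → ℝ} (hu : Summable u) (n : ℕ) :
    ∑' i, u (i + n) = u n + ∑' i, u (i + (n + 1)) := by
  rw [((summable_nat_add_iff n).2 hu).tsum_eq_zero_add]
  simp [add_assoc, add_comm 1 n]

/-- Kakeya's greedy expansion with digits `0, …, s`. -/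
theorem exists_digits {u : ℕ → ℝ} (hpos : ∀ n, 0 < u n) (hu : Summable u) {s : ℕ}
    (hs : ∀ n, u n ≤ s * ∑' i, u (i + (n + 1))) {y : ℝ} (hy0 : 0 ≤ y) (hy : y ≤ s * ∑' i, u i) :
    ∃ j : ℕ → ℕ, (∀ n, j n ≤ s) ∧ HasSum (fun n => j n * u n) y := by
  classical
  have hstep : ∀ (n : ℕ) (v : ℝ), ∃ d : ℕ, 0 ≤ v → v ≤ s * ∑' i, u (i + n) →
      d ≤ s ∧ 0 ≤ v - d * u n ∧ v - d * u n ≤ s * ∑' i, u (i + (n + 1)) := by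
    intro n v
    -- The largest admissible digit is taken; when it is a floor, the remainder is below `u n`,
    -- which `hs` bounds.
    by_cases h : s * u n ≤ v
    · refine ⟨s, fun _ hv => ⟨le_rfl, by linarith, ?_⟩⟩
      rw [tsum_nat_add_eq_add hu n] at hv
      linarith
    · refine ⟨⌊v / u n⌋₊, fun hv0 _ => ?_⟩
      have h1 := Nat.floor_le (div_nonneg hv0 (hpos n).le)
      have h2 := Nat.lt_floor_add_one (v / u n)
      rw [le_div_iff₀ (hpos n)] at h1
      rw [div_lt_iff₀ (hpos n)] at h2
      refine ⟨?_, by linarith, by linarith [hs n]⟩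
      have h3 : (⌊v / u n⌋₊ : ℝ) * u n < s * u n := h1.trans_lt (not_le.1 h)
      exact_mod_cast (lt_of_mul_lt_mul_right h3 (hpos n).le).le
  choose d hd using hstep
  let Y : ℕ → ℝ := fun n => Nat.rec y (fun n v => v - d n v * u n) n
  have hY : ∀ n, Y (n + 1) = Y n - d n (Y n) * u n := fun n => rfl
  have hinv : ∀ n, 0 ≤ Y n ∧ Y n ≤ s * ∑' i, u (i + n) := by
    intro n
    induction n with
    | zero => exact ⟨hy0, hy⟩
    | succ n ih => exact (hd n (Y n) ih.1 ih.2).2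
  refine ⟨fun n => d n (Y n), fun n => (hd n (Y n) (hinv n).1 (hinv n).2).1, ?_⟩
  rw [hasSum_iff_tendsto_nat_of_nonneg fun n => mul_nonneg (Nat.cast_nonneg _) (hpos n).le]
  have hsum : ∀ n, ∑ i ∈ Finset.range n, (d i (Y i) : ℝ) * u i = y - Y n := by
    intro n
    induction n with
    | zero => simp [Y]
    | succ n ih =>
      rw [Finset.sum_range_succ, ih, hY]
      ring
  have hY0 : Tendsto Y atTop (𝓝 0) :=
    squeeze_zero (fun n => (hinv n).1) (fun n => (hinv n).2) <| by
      simpa using (tendsto_sum_nat_add u).const_mul (s : ℝ)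
  simpa [hsum] using hY0.const_sub y

/-- Taking the subsum `mu + j n * lam` in block `n` gives `mu * ∑ u + lam * ∑ j n * u n`, and the
digit sums fill an interval. -/
theorem interior_achievementSet_blockSeq_nonempty {m : ℕ} (hm : 0 < m) (k : Fin m → ℝ)
    {u : ℕ → ℝ} (hpos : ∀ n, 0 < u n) (hu : Summable u) {lam mu : ℝ} (hlam : 0 < lam) {s : ℕ}
    (hsub : ∀ j : ℕ, j ≤ s → mu + j * lam ∈ finiteSubsums k)
    (hs : ∀ n, u n ≤ s * ∑' i, u (i + (n + 1))) :
    (interior (achievementSet (blockSeq hm k u))).Nonempty := by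
  have hU : 0 < ∑' i, u i := hu.tsum_pos (fun n => (hpos n).le) 0 (hpos 0)
  have hs0 : (0 : ℝ) < s := by
    rcases Nat.eq_zero_or_pos s with rfl | h
    · have := hs 0
      have := hpos 0
      simp at *
      linarith
    · exact_mod_cast h
  set a := mu * ∑' i, u i
  have hsubset : Icc a (a + lam * (s * ∑' i, u i)) ⊆ achievementSet (blockSeq hm k u) := by
    intro y hy
    obtain ⟨j, hj, hsum⟩ := exists_digits hpos hu hs (y := (y - a) / lam)
      (div_nonneg (by linarith [hy.1]) hlam.le)
      (by rw [div_le_iff₀ hlam]; linarith [hy.2])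
    choose I hI using fun n => hsub (j n) (hj n)
    refine ⟨_, hasSum_indicator_blockSeq hm k hu I ?_⟩
    have h1 := (hu.hasSum.mul_left mu).add (hsum.mul_left lam)
    rw [mul_div_cancel₀ _ hlam.ne', add_sub_cancel] at h1
    refine h1.congr_fun fun n => ?_
    rw [hI]
    ring
  have hlt : a < a + lam * (s * ∑' i, u i) := by
    have := mul_pos hlam (mul_pos hs0 hU)
    linarith
  refine (nonempty_Ioo.2 hlt).mono ?_
  rw [← interior_Icc]
  exact interior_mono hsubset

/-! ### Cantorval criterion and power bounds -/

theorem isCantorval_blockSeq {m : ℕ} (hm : 0 < m) {k : Fin m → ℝ} (hk_pos : ∀ i, 0 < k i)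
    (hk_anti : Antitone k) {u : ℕ → ℝ} (hu : Summable u) {N₀ : ℕ} (hpos : ∀ n ≥ N₀, 0 < u n)
    (hanti : ∀ i ≥ N₀, ∀ j ≥ i, u j ≤ u i) {lam mu : ℝ} (hlam : 0 < lam) {s : ℕ}
    (hsub : ∀ j : ℕ, j ≤ s → mu + j * lam ∈ finiteSubsums k)
    (hs : ∀ n ≥ N₀, u n ≤ s * ∑' i, u (i + (n + 1)))
    (hgap : ∀ n ≥ N₀, (∑ i, k i) * ∑' i, u (i + (n + 1)) <
      k ⟨m - 1, Nat.sub_one_lt_of_lt hm⟩ * u n) :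
    IsCantorval (achievementSet (blockSeq hm k u)) := by
  have hdiv : ∀ i, N₀ * m ≤ i → N₀ ≤ i / m := fun i hi => (Nat.le_div_iff_mul_le hm).2 hi
  refine isCantorval_achievementSet (n₀ := N₀ * m) (summable_blockSeq hm k hu)
    (fun n hn => (mul_pos (hk_pos _) (hpos _ (hdiv n hn))).le) (fun N => ?_) fun N => ?_
  -- The cut falls at the end of block `max N N₀`, whose last term is the least one from `N₀ * m` up
  -- to the cut.
  · refine ⟨(max N N₀ + 1) * m, ?_,
      k ⟨m - 1, Nat.sub_one_lt_of_lt hm⟩ * u (max N N₀), ?_, fun i hi hi' => ?_⟩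
    · calc N ≤ max N N₀ + 1 := (le_max_left _ _).trans (Nat.le_succ _)
        _ ≤ _ := Nat.le_mul_of_pos_right _ hm
    · simp_rw [blockSeq_add_mul]
      rw [tsum_blockSeq hm k ((summable_nat_add_iff _).2 hu)]
      exact hgap _ (le_max_right _ _)
    · have h1 : i / m ≤ max N N₀ := Nat.lt_succ_iff.1 ((Nat.div_lt_iff_lt_mul hm).2 hi')
      have h2 := hdiv i hi
      refine mul_le_mul (hk_anti ?_) (hanti _ h2 _ h1) (hpos _ (le_max_right _ _)).le (hk_pos _).le
      rw [Fin.le_def]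
      exact Nat.le_sub_one_of_lt (Nat.mod_lt i hm)
  · refine ⟨max N N₀ * m, (le_max_left N N₀).trans (Nat.le_mul_of_pos_right _ hm), ?_⟩
    simp_rw [blockSeq_add_mul]
    refine interior_achievementSet_blockSeq_nonempty hm k (fun n => hpos _ ?_)
      ((summable_nat_add_iff _).2 hu) hlam hsub fun n => ?_
    · exact le_add_left (le_max_right _ _)
    · refine (hs (n + max N N₀) (le_add_left (le_max_right _ _))).trans_eq ?_
      congr 2
      ext i
      congr 1
      ring

theorem mainTheorem2
    (f : ℝ → ℝ) (ε a b r : ℝ) (hf : IsLocallyIncreasingPowerBounded f ε a b r)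
    (m : ℕ) (hm : 0 < m) (k : Fin m → ℝ) (hk_pos : ∀ i, 0 < k i) (hk_anti : Antitone k)
    (lam mu : ℝ) (hlam : 0 < lam) (hmu : 0 < mu) (s : ℕ)
    (hsub : ∀ j : ℕ, j ≤ s → mu + j * lam ∈ finiteSubsums k)
    (hd : dCI a b r s < dNI hm k a b r)
    (x : ℝ) (hx : x ∈ Ico (dCI a b r s) (dNI hm k a b r)) :
    IsCantorval (achievementSet (genMultigeometric hm k f x)) := by
  obtain ⟨hε, hε1, ha, hb, hr, hmono, hlow, hup⟩ := hf
  set c := k ⟨m - 1, Nat.sub_one_lt_of_lt hm⟩ with hc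
  have hc0 : 0 < c := hk_pos _
  have : Nonempty (Fin m) := ⟨⟨0, hm⟩⟩
  have hK : 0 < ∑ i, k i := Finset.sum_pos (fun i _ => hk_pos i) Finset.univ_nonempty
  have hsab : 0 < s * a + b := by positivity
  have hx0 : 0 < x := lt_of_lt_of_le (by unfold dCI; positivity) hx.1
  set q := x ^ r with hq
  have hq0 : 0 < q := Real.rpow_pos_of_pos hx0 r
  have hq_low : b ≤ q * (s * a + b) := by
    rw [← div_le_iff₀ hsab]
    have := Real.rpow_le_rpow (by unfold dCI; positivity) hx.1 hr.le
    rwa [dCI, one_div, Real.rpow_inv_rpow (by positivity) hr.ne'] at this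
  have hq_up : q * (b * (∑ i, k i) + a * c) < a * c := by
    rw [← lt_div_iff₀ (by positivity)]
    have := Real.rpow_lt_rpow hx0.le hx.2 hr
    rwa [dNI, one_div, Real.rpow_inv_rpow (by positivity) hr.ne'] at this
  have hq1 : q < 1 := by
    have h1 := mul_pos hq0 (mul_pos hb hK)
    have h2 := mul_pos ha hc0
    nlinarith
  have hx1 : x < 1 := by
    by_contra! h
    exact absurd (Real.one_le_rpow h hr.le) (not_le.2 hq1)
  obtain ⟨N₀, hN₀⟩ := exists_pow_lt_of_lt_one hε hx1
  have hmem : ∀ n ≥ N₀, x ^ (n + 1) ∈ Icc 0 ε := fun n hn =>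
    ⟨by positivity, (pow_le_pow_of_le_one hx0.le hx1.le (by omega)).trans hN₀.le⟩
  have hpow : ∀ n : ℕ, (x ^ n) ^ r = q ^ n := fun n => by
    rw [← Real.rpow_natCast, ← Real.rpow_natCast, ← Real.rpow_mul hx0.le, ← Real.rpow_mul hx0.le,
      mul_comm]
  set u : ℕ → ℝ := fun n => f (x ^ (n + 1)) with hu_def
  have hul : ∀ n ≥ N₀, a * q ^ (n + 1) ≤ u n := fun n hn => hpow (n + 1) ▸ hlow _ (hmem n hn)
  have huu : ∀ n ≥ N₀, u n ≤ b * q ^ (n + 1) := fun n hn => hpow (n + 1) ▸ hup _ (hmem n hn)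
  have hpos : ∀ n ≥ N₀, 0 < u n := fun n hn => lt_of_lt_of_le (by positivity) (hul n hn)
  have hgeom : ∀ (d : ℝ) (n : ℕ), HasSum (fun i => d * q ^ (i + n + 1))
      (d * q ^ (n + 1) / (1 - q)) := by
    intro d n
    have := (hasSum_geometric_of_lt_one hq0.le hq1).mul_left (d * q ^ (n + 1))
    rw [← div_eq_mul_inv] at this
    refine this.congr_fun fun i => ?_
    ring
  have hu : Summable u := by
    rw [← summable_nat_add_iff N₀]
    exact Summable.of_nonneg_of_le (fun i => (hpos _ (by omega)).le) (fun i => huu _ (by omega))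
      (hgeom b N₀).summable
  have hq1' : 0 < 1 - q := sub_pos.2 hq1
  have hblock : genMultigeometric hm k f x = blockSeq hm k u := rfl
  rw [hblock]
  refine isCantorval_blockSeq hm hk_pos hk_anti hu hpos ?_ hlam hsub ?_ ?_
  · exact fun i hi j hj => hmono (hmem j (hi.le.trans hj)) (hmem i hi)
      (pow_le_pow_of_le_one hx0.le hx1.le (by omega))
  · intro n hn
    have h1 : a * q ^ (n + 1 + 1) / (1 - q) ≤ ∑' i, u (i + (n + 1)) :=
      hasSum_le (fun i => hul _ (by omega)) (hgeom a (n + 1)) ((summable_nat_add_iff _).2 hu).hasSum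
    calc u n ≤ b * q ^ (n + 1) := huu n hn
      _ ≤ s * (a * q ^ (n + 1 + 1) / (1 - q)) := by
        rw [← mul_div_assoc, le_div_iff₀ hq1']
        have h2 : b * (1 - q) ≤ s * a * q := by linarith
        calc b * q ^ (n + 1) * (1 - q) = b * (1 - q) * q ^ (n + 1) := by ring
          _ ≤ s * a * q * q ^ (n + 1) := by gcongr
          _ = _ := by ring
      _ ≤ _ := by gcongr
  · intro n hn
    have h1 : ∑' i, u (i + (n + 1)) ≤ b * q ^ (n + 1 + 1) / (1 - q) :=
      hasSum_le (fun i => huu _ (by omega)) ((summable_nat_add_iff _).2 hu).hasSum (hgeom b (n + 1))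
    calc (∑ i, k i) * ∑' i, u (i + (n + 1))
        ≤ (∑ i, k i) * (b * q ^ (n + 1 + 1) / (1 - q)) := by gcongr
      _ < c * (a * q ^ (n + 1)) := by
        rw [← mul_div_assoc, div_lt_iff₀ hq1']
        have h2 : (∑ i, k i) * b * q < c * a * (1 - q) := by linarith
        calc (∑ i, k i) * (b * q ^ (n + 1 + 1)) = (∑ i, k i) * b * q * q ^ (n + 1) := by ring
          _ < c * a * (1 - q) * q ^ (n + 1) := by gcongr
          _ = _ := by ring
      _ ≤ c * u n := by gcongr; exact hul n hn
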